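/- For an entire function $f$ let $\Lambda_f$ be the set of all its zeros, and call $f$ of minimal exponential type if $\limsup_{r\to\infty} r^{-1}\log\sup_{|z|=r}|f(z)| = 0$. Let $\mathcal{E}_0(\mathbb{R})$ be the family of all entire functions of minimal exponential type which are real on the real axis and have only real simple zeros. Let $B\in\mathcal{E}_0(\mathbb{R})$ and assume that $\sum_{\lambda\in\Lambda_B} \frac{1}{|B'(\lambda)|}<\infty$. Then for every $\delta>0$ there exist constants $C_\delta=C_\delta(B)>0$ and $\rho_\delta=\rho_\delta(B)>0$ such that for every family of real numbers $\{d_\lambda\}_{\lambda\in\Lambda_B}$ satisfying $$|\lambda-d_\lambda|\le \rho_\delta\, e^{-\delta|\lambda|},\qquad \lambda\in\Lambda_B,$$ there exists an entire function $D\in\mathcal{E}_0(\mathbb{R})$ such that $\Lambda_D=\{d_\lambda\}_{\lambda\in\Lambda_B}$ and $$|B'(\lambda)|\le C_\delta\,|D'(d_\lambda)|,\qquad \lambda\in\Lambda_B.$$ -/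

import Mathlib

open Filter
open scoped ENNReal

/-- The maximum modulus `M_f(r) = sup_{|z| = r} |f(z)|`, as an element of `[0, ∞]`. -/
noncomputable def maxModulus (f : ℂ → ℂ) (r : ℝ) : ℝ≥0∞ :=
  ⨆ z ∈ Metric.sphere (0 : ℂ) r, ‖f z‖ₑ

/-- The type `σ_f(ρ) = limsup_{r → ∞} r^{-ρ} log M_f(r)` of `f` with respect to the order `ρ`,
as an extended real number (with `log 0 = -∞`, `log ∞ = ∞`). -/
noncomputable def growthType (f : ℂ → ℂ) (ρ : ℝ) : EReal :=
  limsup (fun r : ℝ => ((r ^ (-ρ) : ℝ) : EReal) * ENNReal.log (maxModulus f r)) atTop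

/-- `f` is of minimal exponential type. -/
def IsMinimalExpType (f : ℂ → ℂ) : Prop := growthType f 1 = 0

/-- The set `Λ_f` of all (complex) zeros of `f`. -/
def zeroSet (f : ℂ → ℂ) : Set ℂ := {z | f z = 0}

/-- The class `𝓔₀(ℝ)`: entire functions of minimal exponential type that are real on the
real axis and all of whose zeros are real and simple. -/
structure IsE0 (f : ℂ → ℂ) : Prop where
  entire : Differentiable ℂ f
  minimalExpType : IsMinimalExpType f
  real_on_real : ∀ x : ℝ, (f x).im = 0
  zeros_real : ∀ z ∈ zeroSet f, z.im = 0
  zeros_simple : ∀ z ∈ zeroSet f, deriv f z ≠ 0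

/-! Take `D = B · ∏ (z - d_l)/(z - l) = B · ∏ (1 + a_l/(z - l))` with `a_l = l - d_l`. Put `δ = 2η`
and `w_l = exp(-η|l|)`, so `|a_l| ≤ ρ w_l²`. Minimal type gives `|B'(l)| ≤ M/w_l`, so `∑ w_l`
converges along with `∑ 1/|B'(l)|`; moreover `|B'|` is bounded below on the zeros. A Cauchy-type
bound on `B` near `l` then keeps the other zeros at distance at least `s w_l`
(`norm_dslope_sub_deriv_le`). Hence at `d_m` the factors with `l ≠ m` differ from 1 by `O(ρ w_l)`,
and for small `ρ` their product stays away from 0, which compares `D'(d_m)` with `B'(m)`. For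
growth, around any point some circle of radius in `[1, 2]` avoids small discs about all zeros; the
product is bounded there, and the maximum principle transfers the bound on `B` to `D`. -/

/-! ### Minimal exponential type as pointwise bounds. -/

theorem IsMinimalExpType.exists_norm_le {f : ℂ → ℂ} (hf : IsMinimalExpType f) (hc : Continuous f)
    {η : ℝ} (hη : 0 < η) : ∃ A : ℝ, 0 < A ∧ ∀ z, ‖f z‖ ≤ A * Real.exp (η * ‖z‖) := by
  have h : growthType f 1 < (η : EReal) := by
    rw [show growthType f 1 = 0 from hf]
    exact_mod_cast hη
  obtain ⟨R, hR⟩ := eventually_atTop.1 ((eventually_lt_of_limsup_lt h).and (eventually_gt_atTop 0))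
  obtain ⟨A, hA⟩ := (isCompact_closedBall (0 : ℂ) R).exists_bound_of_continuousOn hc.continuousOn
  refine ⟨max A 1, by positivity, fun z => ?_⟩
  have hexp : 1 ≤ Real.exp (η * ‖z‖) := Real.one_le_exp (by positivity)
  rcases le_total ‖z‖ R with hz | hz
  · calc ‖f z‖ ≤ max A 1 := (hA z (by simpa using hz)).trans (le_max_left _ _)
      _ ≤ max A 1 * Real.exp (η * ‖z‖) := le_mul_of_one_le_right (by positivity) hexp
  · obtain ⟨h1, h2⟩ := hR ‖z‖ hz
    have key : ‖f z‖ ≤ Real.exp (η * ‖z‖) := by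
      by_cases h0 : f z = 0
      · simp [h0, Real.exp_nonneg]
      have hpos : 0 < ‖f z‖ := norm_pos_iff.2 h0
      have hle : ((Real.log ‖f z‖ : ℝ) : EReal) ≤ ENNReal.log (maxModulus f ‖z‖) := by
        rw [← ENNReal.log_ofReal_of_pos hpos, ofReal_norm]
        exact ENNReal.log_monotone (le_iSup₂_of_le z (by simp) le_rfl)
      have h3 : ((‖z‖ ^ (-1 : ℝ) : ℝ) : EReal) * ((Real.log ‖f z‖ : ℝ) : EReal) < η :=
        (mul_le_mul_of_nonneg_left hle (by exact_mod_cast (by positivity))).trans_lt h1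
      have h4 : ‖z‖ ^ (-1 : ℝ) * Real.log ‖f z‖ < η := by exact_mod_cast h3
      rw [Real.rpow_neg_one, inv_mul_lt_iff₀ h2] at h4
      rw [← Real.log_le_iff_le_exp hpos]
      linarith
    exact key.trans (le_mul_of_one_le_left (Real.exp_nonneg _) (le_max_right _ _))

theorem enorm_le_maxModulus {f : ℂ → ℂ} (hf : Differentiable ℂ f) {z : ℂ} {r : ℝ} (hr : 0 < r)
    (hz : ‖z‖ ≤ r) : ‖f z‖ₑ ≤ maxModulus f r := by
  obtain ⟨w, hw, hmax⟩ := (isCompact_sphere (0 : ℂ) r).exists_isMaxOn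
    (NormedSpace.sphere_nonempty.2 hr.le) hf.continuous.norm.continuousOn
  have h1 : ‖f z‖ ≤ ‖f w‖ := by
    refine Complex.norm_le_of_forall_mem_frontier_norm_le (U := Metric.ball 0 r)
      Metric.isBounded_ball hf.diffContOnCl (fun x hx => hmax ?_) ?_
    · rwa [frontier_ball _ hr.ne'] at hx
    · rw [closure_ball _ hr.ne']
      simpa using hz
  calc ‖f z‖ₑ ≤ ‖f w‖ₑ := enorm_le_iff_norm_le.2 h1
    _ ≤ _ := le_iSup₂_of_le w hw le_rfl

/-- The point `z₀` excludes the zero function, whose type is `-∞`: by the maximum principle `M_f(r)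
≥ |f z₀|` for large `r`, so the limsup is nonnegative. -/
theorem IsMinimalExpType.of_norm_le {f : ℂ → ℂ} (hf : Differentiable ℂ f)
    (h : ∀ η : ℝ, 0 < η → ∃ A : ℝ, 0 < A ∧ ∀ z, ‖f z‖ ≤ A * Real.exp (η * ‖z‖))
    {z₀ : ℂ} (hz₀ : f z₀ ≠ 0) : IsMinimalExpType f := by
  have hlim : ∀ a b : ℝ, Tendsto (fun r : ℝ => ((r⁻¹ * a + b : ℝ) : EReal)) atTop (nhds (b : EReal)) := by
    intro a b
    refine (continuous_coe_real_ereal.tendsto b).comp ?_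
    simpa using (tendsto_inv_atTop_zero.mul_const a).add_const b
  refine le_antisymm ?_ ?_
  · refine EReal.le_of_forall_lt_iff_le.1 fun η hη => ?_
    obtain ⟨A, hA, hbd⟩ := h η (by exact_mod_cast hη)
    rw [← (hlim (Real.log A) η).limsup_eq]
    refine limsup_le_limsup ?_
    filter_upwards [eventually_gt_atTop 0] with r hr
    have h1 : maxModulus f r ≤ ENNReal.ofReal (A * Real.exp (η * r)) := by
      refine iSup₂_le fun z hz => ?_
      rw [← ofReal_norm]
      refine ENNReal.ofReal_le_ofReal ?_
      have := hbd z
      rwa [mem_sphere_zero_iff_norm.1 hz] at this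
    have h2 := ENNReal.log_monotone h1
    rw [ENNReal.log_ofReal_of_pos (by positivity),
      Real.log_mul hA.ne' (Real.exp_ne_zero _), Real.log_exp] at h2
    refine (mul_le_mul_of_nonneg_left h2 (by exact_mod_cast (by positivity))).trans ?_
    rw [← EReal.coe_mul, EReal.coe_le_coe_iff, Real.rpow_neg_one]
    apply le_of_eq
    field_simp
  · have h0 : (0 : EReal) = ((0 : ℝ) : EReal) := rfl
    rw [h0, ← (hlim (Real.log ‖f z₀‖) 0).limsup_eq]
    refine limsup_le_limsup ?_
    filter_upwards [eventually_gt_atTop 0, eventually_ge_atTop ‖z₀‖] with r hr hr'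
    have h1 := ENNReal.log_monotone (enorm_le_maxModulus hf hr hr')
    rw [← ofReal_norm, ENNReal.log_ofReal_of_pos (norm_pos_iff.2 hz₀)] at h1
    refine le_trans ?_ (mul_le_mul_of_nonneg_left h1 (by exact_mod_cast (by positivity)))
    rw [← EReal.coe_mul, EReal.coe_le_coe_iff, Real.rpow_neg_one, add_zero]

/-! ### Cauchy-type estimates near a zero. -/

theorem norm_deriv_le_of_norm_le_exp {f : ℂ → ℂ} (hf : Differentiable ℂ f) {A η : ℝ} (hA : 0 < A)
    (hη : 0 < η) (h : ∀ z, ‖f z‖ ≤ A * Real.exp (η * ‖z‖)) (z : ℂ) :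
    ‖deriv f z‖ ≤ A * Real.exp η * Real.exp (η * ‖z‖) := by
  have := Complex.norm_deriv_le_of_forall_mem_sphere_norm_le (c := z) (R := 1)
    (C := A * Real.exp η * Real.exp (η * ‖z‖)) (f := f) one_pos hf.diffContOnCl ?_
  · simpa using this
  · intro w hw
    have hw' : ‖w‖ ≤ 1 + ‖z‖ := by
      rw [mem_sphere_iff_norm] at hw
      have := norm_add_le (w - z) z
      simp only [sub_add_cancel, hw] at this
      exact this
    rw [mul_assoc, ← Real.exp_add]
    refine (h w).trans ?_
    gcongr
    nlinarith

theorem differentiable_dslope {f : ℂ → ℂ} (hf : Differentiable ℂ f) (l : ℂ) :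
    Differentiable ℂ (dslope f l) := by
  rw [← differentiableOn_univ] at hf ⊢
  exact (Complex.differentiableOn_dslope univ_mem).2 hf

/-- The second divided difference at `l` is entire, so its bound on the unit circle about `l`
persists inside. -/
theorem norm_dslope_sub_deriv_le {f : ℂ → ℂ} (hf : Differentiable ℂ f) {A η : ℝ} (hA : 0 < A)
    (hη : 0 < η) (h : ∀ z, ‖f z‖ ≤ A * Real.exp (η * ‖z‖)) {l z : ℂ} (hl : f l = 0)
    (hz : ‖z - l‖ ≤ 1) :
    ‖dslope f l z - deriv f l‖ ≤ 2 * (A * Real.exp η) * Real.exp (η * ‖l‖) * ‖z - l‖ := by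
  have hg := differentiable_dslope hf l
  have hh := differentiable_dslope hg l
  have hbd : ‖dslope (dslope f l) l z‖ ≤ 2 * (A * Real.exp η) * Real.exp (η * ‖l‖) := by
    refine Complex.norm_le_of_forall_mem_frontier_norm_le (U := Metric.ball l 1)
      Metric.isBounded_ball hh.diffContOnCl (fun w hw => ?_) ?_
    · rw [frontier_ball _ one_ne_zero, mem_sphere_iff_norm] at hw
      have hne : w ≠ l := by
        rintro rfl
        simp at hw
      have h1 : ‖dslope f l w‖ = ‖f w‖ := by
        rw [dslope_of_ne _ hne, slope_def_module, norm_smul, norm_inv, hw, hl]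
        simp
      have hw' : ‖w‖ ≤ 1 + ‖l‖ := by
        have := norm_add_le (w - l) l
        simp only [sub_add_cancel, hw] at this
        exact this
      have h2 : ‖f w‖ ≤ A * Real.exp η * Real.exp (η * ‖l‖) := by
        rw [mul_assoc, ← Real.exp_add]
        refine (h w).trans ?_
        gcongr
        nlinarith
      have h3 := norm_deriv_le_of_norm_le_exp hf hA hη h l
      rw [dslope_of_ne _ hne, slope_def_module, norm_smul, norm_inv, hw, dslope_same]
      have h4 := norm_sub_le (dslope f l w) (deriv f l)
      rw [inv_one, one_mul]
      linarith
    · rw [closure_ball _ one_ne_zero]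
      simpa [dist_eq_norm] using hz
  have heq : dslope f l z - deriv f l = (z - l) * dslope (dslope f l) l z := by
    rw [← smul_eq_mul, sub_smul_dslope, dslope_same]
  rw [heq, norm_mul, mul_comm]
  gcongr

/-- The product `∏ (1 + a_l / (z - l))`; a factor with `z = l` equals `1`. -/
noncomputable def ratioProd {L : Set ℂ} (a : L → ℂ) (z : ℂ) : ℂ := ∏' l : L, (1 + a l / (z - l))

/-! ### Convergence and size of the correcting product. -/

section ratioProd

variable {L : Set ℂ} {a : L → ℂ} {z : ℂ} {r : ℝ}

theorem norm_div_sub_le (hr : 0 < r) (h : ∀ l : L, a l ≠ 0 → r ≤ ‖z - l‖) (l : L) :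
    ‖a l / (z - l)‖ ≤ r⁻¹ * ‖a l‖ := by
  by_cases h0 : a l = 0
  · simp [h0]
  · rw [norm_div, div_eq_inv_mul]
    gcongr
    exact h l h0

/-- Only indices with `a l ≠ 0` are constrained, so that setting `a m = 0` yields differentiability
at `m` itself. -/
theorem ratioProd_differentiableAt (ha : Summable fun l => ‖a l‖) (hr : 0 < r)
    (h : ∀ l : L, a l ≠ 0 → 2 * r ≤ ‖z - l‖) : DifferentiableAt ℂ (ratioProd a) z := by
  have hball : ∀ w ∈ Metric.ball z r, ∀ l : L, a l ≠ 0 → r ≤ ‖w - l‖ := by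
    intro w hw l hl
    have h1 := h l hl
    have h2 : ‖z - w‖ < r := by rwa [mem_ball_iff_norm'] at hw
    have h3 := norm_add_le (z - w) (w - l)
    rw [sub_add_sub_cancel] at h3
    linarith
  have hd : ∀ l : L, DifferentiableOn ℂ (fun w => a l / (w - l)) (Metric.ball z r) := by
    intro l
    by_cases h0 : a l = 0
    · simp [h0]
    · intro w hw
      have : w - l ≠ 0 := norm_pos_iff.1 (hr.trans_le (hball w hw l h0))
      exact (by fun_prop (disch := exact this) : DifferentiableAt ℂ
        (fun w => a l / (w - l)) w).differentiableWithinAt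
  have hp := Summable.hasProdLocallyUniformlyOn_one_add (f := fun (l : L) w => a l / (w - l))
    (Metric.isOpen_ball (x := z) (ε := r)) (ha.mul_left r⁻¹)
    (Eventually.of_forall fun l w hw => norm_div_sub_le hr (hball w hw) l)
    fun l => (hd l).continuousOn
  have hdiff : DifferentiableOn ℂ (ratioProd a) (Metric.ball z r) :=
    (hasProdLocallyUniformlyOn_iff_tendstoLocallyUniformlyOn.1 hp).differentiableOn
      (Eventually.of_forall fun s =>
        DifferentiableOn.fun_finsetProd fun l _ => (hd l).const_add 1) Metric.isOpen_ball
  exact hdiff.differentiableAt (Metric.ball_mem_nhds z hr)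

theorem ratioProd_eq_mul (ha : Summable fun l : L => ‖a l / (z - l)‖) (m : L) [DecidableEq L] :
    ratioProd a z = (1 + a m / (z - m)) * ratioProd (Function.update a m 0) z := by
  unfold ratioProd
  rw [Multipliable.tprod_eq_mul_tprod_ite' m]
  · congr 1
    refine tprod_congr fun l => ?_
    by_cases hl : l = m
    · simp [hl]
    · simp [hl]
  · have : (Function.update (fun l : L => 1 + a l / (z - l)) m 1) =
        fun l : L => 1 + (Function.update a m 0 l) / (z - l) := by
      funext l
      by_cases hl : l = m
      · subst hl; simp
      · simp [hl]
    rw [this]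
    refine multipliable_one_add_of_summable (ha.of_nonneg_of_le (fun _ => norm_nonneg _) fun l => ?_)
    by_cases hl : l = m
    · subst hl
      simpa using div_nonneg (norm_nonneg _) (norm_nonneg _)
    · simp [hl]

theorem ratioProd_ne_zero (ha : Summable fun l : L => ‖a l / (z - l)‖)
    (h : ∀ l : L, z ≠ l → z ≠ l - a l) : ratioProd a z ≠ 0 := by
  refine tprod_one_add_ne_zero_of_summable (fun l => ?_) ha
  by_cases hz : z = l
  · simp [hz]
  · have h1 : z - l ≠ 0 := sub_ne_zero.2 hz
    intro h2
    apply h l hz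
    field_simp at h2
    linear_combination h2

theorem norm_ratioProd_sub_one_le (ha : Summable fun l : L => ‖a l / (z - l)‖) :
    ‖ratioProd a z - 1‖ ≤ Real.exp (∑' l : L, ‖a l / (z - l)‖) - 1 := by
  refine le_of_tendsto ((((multipliable_one_add_of_summable ha).hasProd).sub_const 1).norm) ?_
  refine Eventually.of_forall fun s => (s.norm_prod_one_add_sub_one_le _).trans ?_
  gcongr
  exact ha.sum_le_tsum _ fun _ _ => norm_nonneg _

end ratioProd

/-- The bad radii lie in intervals of total length `2 ∑ t < 1`, which cannot cover `[1, 2]`. -/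
theorem exists_radius_avoiding {L : Set ℂ} [Countable L] {t : L → ℝ} (ht : ∀ l, 0 ≤ t l)
    (hs : Summable t) (hlt : 2 * ∑' l, t l < 1) (z : ℂ) :
    ∃ r ∈ Set.Icc (1 : ℝ) 2, ∀ l : L, t l ≤ |r - ‖z - l‖| := by
  by_contra! hcon
  have hsub : Set.Icc (1 : ℝ) 2 ⊆ ⋃ l : L, Metric.ball ‖z - l‖ (t l) := by
    intro r hr
    obtain ⟨l, hl⟩ := hcon r hr
    exact Set.mem_iUnion.2 ⟨l, by rwa [Metric.mem_ball, Real.dist_eq]⟩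
  have h1 := (MeasureTheory.measure_mono hsub).trans
    (MeasureTheory.measure_iUnion_le (μ := MeasureTheory.volume) _)
  simp only [Real.volume_ball, Real.volume_Icc] at h1
  rw [← ENNReal.ofReal_tsum_of_nonneg (fun l => by have := ht l; positivity) (hs.mul_left 2),
    tsum_mul_left, ENNReal.ofReal_le_ofReal_iff
      (mul_nonneg two_pos.le (tsum_nonneg ht))] at h1
  linarith

/-- The function `f` with every zero `l` moved to `l - a l`. -/
noncomputable def moveZeros (f : ℂ → ℂ) (a : zeroSet f → ℂ) (z : ℂ) : ℂ :=
  open Classical in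
  (if h : z ∈ zeroSet f then deriv f z * a ⟨z, h⟩ else f z) * ratioProd a z

/-! ### The function with displaced zeros. -/

section moveZeros

variable {f : ℂ → ℂ} {a : zeroSet f → ℂ}

theorem zeroSet_isolated (hf : Differentiable ℂ f) (hs : ∀ z ∈ zeroSet f, deriv f z ≠ 0) (z : ℂ) :
    ∃ r : ℝ, 0 < r ∧ ∀ l ∈ zeroSet f, l ≠ z → 2 * r ≤ ‖z - l‖ := by
  have hev : ∀ᶠ w in nhdsWithin z {z}ᶜ, f w ≠ 0 := by
    by_cases hz : f z = 0
    · have := (hf z).hasDerivAt.eventually_ne (c := 0) (hs z hz)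
      exact this
    · exact ((hf.continuous.continuousAt).eventually_ne hz).filter_mono nhdsWithin_le_nhds
  rw [eventually_nhdsWithin_iff, Metric.eventually_nhds_iff] at hev
  obtain ⟨ε, hε, h⟩ := hev
  refine ⟨ε / 2, by positivity, fun l hl hne => ?_⟩
  by_contra hlt
  refine h ?_ hne hl
  rw [dist_comm, dist_eq_norm]
  linarith

theorem summable_norm_div_sub (hf : Differentiable ℂ f) (hs : ∀ z ∈ zeroSet f, deriv f z ≠ 0)
    (ha : Summable fun l => ‖a l‖) (z : ℂ) : Summable fun l : zeroSet f => ‖a l / (z - l)‖ := by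
  obtain ⟨r, hr, h⟩ := zeroSet_isolated hf hs z
  refine (ha.mul_left r⁻¹).of_nonneg_of_le (fun _ => norm_nonneg _) fun l => ?_
  by_cases hl : (l : ℂ) = z
  · rw [hl, sub_self, div_zero, norm_zero]
    positivity
  · rw [norm_div, div_eq_inv_mul]
    gcongr
    linarith [h l l.2 hl]

/-- The pole of factor `m` cancels the zero of `f`. At `z = m` that factor is 1 since `x / 0 = 0`,
and the case split in `moveZeros` supplies the limit `f'(m) a_m`. -/
theorem moveZeros_eq_of_ne (hf : Differentiable ℂ f) (hs : ∀ z ∈ zeroSet f, deriv f z ≠ 0)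
    (ha : Summable fun l => ‖a l‖) [DecidableEq (zeroSet f)] (m : zeroSet f) {z : ℂ}
    (hz : ∀ l ∈ zeroSet f, l ≠ m → z ≠ l) :
    moveZeros f a z = dslope f m z * (z - (m - a m)) * ratioProd (Function.update a m 0) z := by
  rw [moveZeros, ratioProd_eq_mul (summable_norm_div_sub hf hs ha z) m]
  by_cases hzm : z = m
  · subst hzm
    simp
  · have hne : z ∉ zeroSet f := fun h => hz z h hzm rfl
    have h1 : z - m ≠ 0 := sub_ne_zero.2 hzm
    have h2 : f z = (z - m) * dslope f m z := by
      rw [← smul_eq_mul, sub_smul_dslope, show f m = 0 from m.2, sub_zero]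
    rw [dif_neg hne, h2]
    field_simp
    ring

theorem summable_norm_update (ha : Summable fun l => ‖a l‖) [DecidableEq (zeroSet f)]
    (m : zeroSet f) : Summable fun l => ‖Function.update a m 0 l‖ := by
  refine ha.of_nonneg_of_le (fun _ => norm_nonneg _) fun l => ?_
  by_cases hl : l = m
  · subst hl
    simp
  · simp [hl]

theorem differentiableAt_ratioProd_update (hf : Differentiable ℂ f)
    (hs : ∀ z ∈ zeroSet f, deriv f z ≠ 0) (ha : Summable fun l => ‖a l‖)
    [DecidableEq (zeroSet f)] (m : zeroSet f) {z : ℂ} (hz : ∀ l ∈ zeroSet f, l ≠ m → z ≠ l) :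
    DifferentiableAt ℂ (ratioProd (Function.update a m 0)) z := by
  obtain ⟨r, hr, h⟩ := zeroSet_isolated hf hs z
  refine ratioProd_differentiableAt (summable_norm_update ha m) hr fun l hl => ?_
  have hlm : l ≠ m := by
    rintro rfl
    simp at hl
  exact h l l.2 (hz l l.2 (by simpa [Subtype.ext_iff] using hlm)).symm

theorem eventually_ne_of_zeroSet (hf : Differentiable ℂ f)
    (hs : ∀ z ∈ zeroSet f, deriv f z ≠ 0) {m z : ℂ} (hz : ∀ l ∈ zeroSet f, l ≠ m → z ≠ l) :
    ∀ᶠ w in nhds z, ∀ l ∈ zeroSet f, l ≠ m → w ≠ l := by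
  obtain ⟨r, hr, h⟩ := zeroSet_isolated hf hs z
  filter_upwards [Metric.ball_mem_nhds z hr] with w hw l hl hlm hwl
  have h1 := h l hl (hz l hl hlm).symm
  rw [mem_ball_iff_norm', hwl] at hw
  linarith

theorem differentiable_moveZeros (hf : Differentiable ℂ f)
    (hs : ∀ z ∈ zeroSet f, deriv f z ≠ 0) (ha : Summable fun l => ‖a l‖) :
    Differentiable ℂ (moveZeros f a) := by
  classical
  intro z
  by_cases hz : z ∈ zeroSet f
  · have hz' : ∀ l ∈ zeroSet f, l ≠ (⟨z, hz⟩ : zeroSet f) → z ≠ l := fun l _ h => Ne.symm h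
    have hev : moveZeros f a =ᶠ[nhds z] fun w => dslope f z w * (w - (z - a ⟨z, hz⟩)) *
        ratioProd (Function.update a ⟨z, hz⟩ 0) w := by
      filter_upwards [eventually_ne_of_zeroSet hf hs hz'] with w hw
      exact moveZeros_eq_of_ne hf hs ha ⟨z, hz⟩ hw
    refine DifferentiableAt.congr_of_eventuallyEq ?_ hev
    exact ((differentiable_dslope hf z z).mul (by fun_prop)).mul
      (differentiableAt_ratioProd_update hf hs ha _ hz')
  · have hev : moveZeros f a =ᶠ[nhds z] fun w => f w * ratioProd a w := by
      filter_upwards [hf.continuous.continuousAt.eventually_ne hz] with w hw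
      exact congrArg (· * _) (dif_neg hw)
    refine DifferentiableAt.congr_of_eventuallyEq ((hf z).mul ?_) hev
    obtain ⟨r, hr, h⟩ := zeroSet_isolated hf hs z
    exact ratioProd_differentiableAt ha hr fun l _ => h l l.2 fun h' => hz (h' ▸ l.2)

theorem deriv_moveZeros (hf : Differentiable ℂ f)
    (hs : ∀ z ∈ zeroSet f, deriv f z ≠ 0) (ha : Summable fun l => ‖a l‖)
    [DecidableEq (zeroSet f)] (m : zeroSet f)
    (hm : ∀ l ∈ zeroSet f, l ≠ m → (m : ℂ) - a m ≠ l) :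
    deriv (moveZeros f a) (m - a m) =
      dslope f m (m - a m) * ratioProd (Function.update a m 0) (m - a m) := by
  have hev : moveZeros f a =ᶠ[nhds (m - a m)] fun w => dslope f m w * (w - (m - a m)) *
      ratioProd (Function.update a m 0) w := by
    filter_upwards [eventually_ne_of_zeroSet hf hs hm] with w hw
    exact moveZeros_eq_of_ne hf hs ha m hw
  rw [hev.deriv_eq]
  have h1 := (differentiable_dslope hf m (m - a m)).hasDerivAt
  have h2 := (hasDerivAt_id ((m : ℂ) - a m)).sub_const ((m : ℂ) - a m)
  have h3 := (differentiableAt_ratioProd_update hf hs ha m hm).hasDerivAt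
  refine ((h1.mul h2).mul h3).deriv.trans ?_
  simp

theorem zeroSet_moveZeros (hf : Differentiable ℂ f)
    (hs : ∀ z ∈ zeroSet f, deriv f z ≠ 0) (ha : Summable fun l => ‖a l‖)
    (hm : ∀ m : zeroSet f, ∀ l ∈ zeroSet f, l ≠ m → (m : ℂ) - a m ≠ l) :
    zeroSet (moveZeros f a) = Set.range fun l : zeroSet f => (l : ℂ) - a l := by
  classical
  ext z
  constructor
  · intro hz
    by_contra hr
    have hr' : ∀ l : zeroSet f, z ≠ l - a l := fun l h => hr ⟨l, h.symm⟩
    rcases mul_eq_zero.1 (show moveZeros f a z = 0 from hz) with h | h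
    · split_ifs at h with hzf
      -- At an old zero, vanishing forces `a = 0`: the zero was not moved.
      · refine (mul_ne_zero (hs z hzf) fun h0 => ?_) h
        exact hr' ⟨z, hzf⟩ (by simp [h0])
      · exact hzf h
    · exact ratioProd_ne_zero (summable_norm_div_sub hf hs ha z) (fun l _ => hr' l) h
  · rintro ⟨m, rfl⟩
    change moveZeros f a _ = 0
    rw [moveZeros_eq_of_ne hf hs ha m (hm m)]
    simp

/-- On a circle about `z` at distance at least `t l` from each zero, the product is at most `exp(∑
|a_l|/t_l)`; the maximum principle brings the bound to `z`. -/
theorem norm_moveZeros_le [Countable (zeroSet f)] (hf : Differentiable ℂ f)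
    (hs : ∀ z ∈ zeroSet f, deriv f z ≠ 0) (ha : Summable fun l => ‖a l‖)
    {t : zeroSet f → ℝ} (ht : ∀ l, 0 < t l) (hts : Summable t) (hlt : 2 * ∑' l, t l < 1)
    (hat : Summable fun l => ‖a l‖ / t l) {A η : ℝ} (hA : 0 < A) (hη : 0 < η)
    (h : ∀ z, ‖f z‖ ≤ A * Real.exp (η * ‖z‖)) (z : ℂ) :
    ‖moveZeros f a z‖ ≤
      A * Real.exp (η * 2) * Real.exp (∑' l, ‖a l‖ / t l) * Real.exp (η * ‖z‖) := by
  obtain ⟨r, ⟨hr1, hr2⟩, hr⟩ := exists_radius_avoiding (fun l => (ht l).le) hts hlt z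
  have hr0 : r ≠ 0 := by positivity
  refine Complex.norm_le_of_forall_mem_frontier_norm_le (U := Metric.ball z r)
    Metric.isBounded_ball (differentiable_moveZeros hf hs ha).diffContOnCl (fun w hw => ?_) ?_
  · rw [frontier_ball _ hr0, mem_sphere_iff_norm] at hw
    have hwl : ∀ l : zeroSet f, t l ≤ ‖w - l‖ := by
      intro l
      refine (hr l).trans ?_
      have h1 := abs_norm_sub_norm_le (w - z) (l - z)
      rw [sub_sub_sub_cancel_right, hw, norm_sub_rev (l : ℂ) z] at h1
      exact h1
    have hwf : w ∉ zeroSet f := by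
      intro hw'
      have h1 := hwl ⟨w, hw'⟩
      simp only [sub_self, norm_zero] at h1
      exact (ht _).not_ge h1
    have hsw := summable_norm_div_sub hf hs ha w
    have hprod : ‖ratioProd a w‖ ≤ Real.exp (∑' l, ‖a l‖ / t l) := by
      have h1 := norm_ratioProd_sub_one_le hsw
      have h2 : ∑' l : zeroSet f, ‖a l / (w - l)‖ ≤ ∑' l, ‖a l‖ / t l := by
        refine hsw.tsum_le_tsum (fun l => ?_) hat
        rw [norm_div]
        exact div_le_div_of_nonneg_left (norm_nonneg _) (ht l) (hwl l)
      have h3 := Real.exp_le_exp.2 h2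
      have h4 := norm_sub_norm_le (ratioProd a w) 1
      rw [norm_one] at h4
      linarith
    have hfw : ‖f w‖ ≤ A * Real.exp (η * 2) * Real.exp (η * ‖z‖) := by
      rw [mul_assoc, ← Real.exp_add]
      refine (h w).trans ?_
      have := norm_add_le (w - z) z
      rw [sub_add_cancel, hw] at this
      gcongr
      nlinarith
    rw [moveZeros, dif_neg hwf, norm_mul, mul_right_comm]
    gcongr
  · exact subset_closure (Metric.mem_ball_self (by positivity))

end moveZeros

/-! ### Reality on the real axis. -/

theorem im_tprod_eq_zero {ι : Type*} {g : ι → ℂ} (hg : ∀ i, (g i).im = 0) :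
    (∏' i, g i).im = 0 := by
  have h1 : g = fun i => (((g i).re : ℝ) : ℂ) := by
    funext i
    exact Complex.ext (by simp) (by simp [hg i])
  rw [h1]
  by_cases h : Multipliable fun i => (((g i).re : ℝ) : ℂ)
  · have hcl : IsClosed {z : ℂ | z.im = 0} := isClosed_eq Complex.continuous_im continuous_const
    refine hcl.mem_of_tendsto h.hasProd (Eventually.of_forall fun s => ?_)
    change (∏ i ∈ s, (((g i).re : ℝ) : ℂ)).im = 0
    rw [← Complex.ofReal_prod, Complex.ofReal_im]
  · rw [tprod_eq_one_of_not_multipliable h, Complex.one_im]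

theorem im_deriv_eq_zero {f : ℂ → ℂ} (hf : Differentiable ℂ f) (h : ∀ x : ℝ, (f x).im = 0)
    (x : ℝ) : (deriv f x).im = 0 := by
  have h1 := (hf (x : ℂ)).hasDerivAt.comp_ofReal
  have h2 := Complex.imCLM.hasFDerivAt.comp_hasDerivAt x h1
  have h3 : (⇑Complex.imCLM ∘ fun y : ℝ => f y) = fun _ => 0 := by
    funext y
    exact h y
  rw [h3] at h2
  exact h2.unique (hasDerivAt_const x 0)

theorem im_moveZeros_eq_zero {f : ℂ → ℂ} {a : zeroSet f → ℂ} (hf : Differentiable ℂ f)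
    (h : ∀ x : ℝ, (f x).im = 0) (hz : ∀ z ∈ zeroSet f, z.im = 0) (ha : ∀ l, (a l).im = 0)
    (x : ℝ) : (moveZeros f a x).im = 0 := by
  have hmul : ∀ u v : ℂ, u.im = 0 → v.im = 0 → (u * v).im = 0 := fun u v hu hv => by
    simp [Complex.mul_im, hu, hv]
  refine hmul _ _ ?_ (im_tprod_eq_zero fun l => ?_)
  · split_ifs with hx
    · exact hmul _ _ (im_deriv_eq_zero hf h x) (ha _)
    · exact h x
  · simp [Complex.div_im, hz l l.2, ha l]

/-! ### Choice of constants and conclusion. -/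

theorem lemma1 (B : ℂ → ℂ) (hB : IsE0 B)
    (hsum : Summable (fun l : zeroSet B => 1 / ‖deriv B (l : ℂ)‖))
    (δ : ℝ) (hδ : 0 < δ) :
    ∃ C ρ : ℝ, 0 < C ∧ 0 < ρ ∧
      ∀ d : zeroSet B → ℝ,
        (∀ l : zeroSet B, ‖(l : ℂ) - (d l : ℂ)‖ ≤ ρ * Real.exp (-δ * ‖(l : ℂ)‖)) →
        ∃ D : ℂ → ℂ, IsE0 D ∧
          zeroSet D = Set.range (fun l : zeroSet B => (d l : ℂ)) ∧
          ∀ l : zeroSet B, ‖deriv B (l : ℂ)‖ ≤ C * ‖deriv D (d l : ℂ)‖ := by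
  classical
  have hf := hB.entire
  have hs := hB.zeros_simple
  have hgrow := fun η (hη : 0 < η) => hB.minimalExpType.exists_norm_le hf.continuous hη
  -- One factor `w` of the decay absorbs the closeness of zeros, the other ensures summability.
  obtain ⟨η, hη0, hδη⟩ : ∃ η : ℝ, 0 < η ∧ δ = 2 * η := ⟨δ / 2, by positivity, by ring⟩
  obtain ⟨A, hA, hbd⟩ := hgrow η hη0
  set w : zeroSet B → ℝ := fun l => Real.exp (-(η * ‖(l : ℂ)‖)) with hw
  have hw0 : ∀ l, 0 < w l := fun l => Real.exp_pos _
  have hw1 : ∀ l, w l ≤ 1 := fun l => Real.exp_le_one_iff.2 (neg_nonpos.2 (by positivity))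
  have hwinv : ∀ l : zeroSet B, Real.exp (η * ‖(l : ℂ)‖) * w l = 1 := fun l => by
    simp only [hw, ← Real.exp_add, add_neg_cancel, Real.exp_zero]
  have hwsq : ∀ l : zeroSet B, Real.exp (-δ * ‖(l : ℂ)‖) = w l * w l := fun l => by
    simp only [hw, ← Real.exp_add, hδη]
    congr 1
    ring
  set M := A * Real.exp η with hM
  have hM0 : 0 < M := by positivity
  have hD0 : ∀ l : zeroSet B, 0 < ‖deriv B l‖ := fun l => norm_pos_iff.2 (hs l l.2)
  have hw_le : ∀ l : zeroSet B, w l ≤ M * (1 / ‖deriv B l‖) := fun l => by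
    rw [mul_one_div, le_div_iff₀ (hD0 l)]
    have h1 := norm_deriv_le_of_norm_le_exp hf hA hη0 hbd l
    calc w l * ‖deriv B l‖ ≤ w l * (M * Real.exp (η * ‖(l : ℂ)‖)) := by
          gcongr
      _ = M * (Real.exp (η * ‖(l : ℂ)‖) * w l) := by ring
      _ = M := by rw [hwinv, mul_one]
  have hws : Summable w := (hsum.mul_left M).of_nonneg_of_le (fun l => (hw0 l).le) hw_le
  have hcount : Countable (zeroSet B) := by
    have h1 := hws.countable_support
    rw [show Function.support w = Set.univ from
      Set.eq_univ_of_forall fun l => (hw0 l).ne'] at h1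
    exact Set.countable_univ_iff.1 h1
  set W := ∑' l, w l with hW
  have hW0 : 0 ≤ W := tsum_nonneg fun l => (hw0 l).le
  obtain ⟨c, hc, hcD⟩ : ∃ c : ℝ, 0 < c ∧ ∀ l : zeroSet B, c ≤ ‖deriv B l‖ := by
    refine ⟨1 / (1 + ∑' l : zeroSet B, 1 / ‖deriv B l‖), ?_, fun l => ?_⟩
    · have : 0 ≤ ∑' l : zeroSet B, 1 / ‖deriv B l‖ := tsum_nonneg fun l => by positivity
      positivity
    · have h1 := hsum.le_tsum l fun _ _ => by positivity
      exact (one_div_le (hD0 l) (by have := hD0 l; have : 0 < 1 / ‖deriv B l‖ := by positivity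
                                    linarith)).1 (by linarith)
  have hds : ∀ (l : zeroSet B) (z : ℂ), ‖z - l‖ ≤ 1 →
      ‖dslope B l z - deriv B l‖ * w l ≤ 2 * M * ‖z - l‖ := fun l z hz => by
    have h1 := norm_dslope_sub_deriv_le hf hA hη0 hbd (show B l = 0 from l.2) hz
    calc _ ≤ 2 * M * Real.exp (η * ‖(l : ℂ)‖) * ‖z - l‖ * w l := by
          gcongr
      _ = 2 * M * (Real.exp (η * ‖(l : ℂ)‖) * w l) * ‖z - l‖ := by ring
      _ = _ := by rw [hwinv, mul_one]
  obtain ⟨s, hs0, hs1, hsM⟩ : ∃ s : ℝ, 0 < s ∧ s ≤ 1 ∧ s * (2 * M) ≤ c := by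
    refine ⟨min 1 (c / (2 * M)), by positivity, min_le_left _ _, ?_⟩
    rw [← le_div_iff₀ (by positivity)]
    exact min_le_right _ _
  have hsep : ∀ l m : zeroSet B, (m : ℂ) ≠ l → s * w l ≤ ‖(m : ℂ) - l‖ := by
    intro l m hne
    rcases le_total ‖(m : ℂ) - l‖ 1 with h1 | h1
    -- At another zero `m` the slope vanishes, so it differs from `B'(l)` by at least `c`.
    · have h2 := hds l m h1
      have h3 : dslope B l m = 0 := by
        rw [dslope_of_ne _ hne, slope_def_module, show B m = 0 from m.2, show B l = 0 from l.2]
        simp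
      rw [h3, zero_sub, norm_neg] at h2
      have h4 : s * (2 * M) * w l ≤ ‖deriv B l‖ * w l :=
        mul_le_mul_of_nonneg_right (hsM.trans (hcD l)) (hw0 l).le
      have h5 : 2 * M * (s * w l) ≤ 2 * M * ‖(m : ℂ) - l‖ := by linarith
      exact le_of_mul_le_mul_left h5 (by positivity)
    · exact (mul_le_one₀ hs1 (hw0 l).le (hw1 l)).trans h1
  -- `4 = 2 · 2`: the slope and the product each lose at most a factor 2. The choice of `ρ` gives
  -- both `ρ ≤ s/8` and `2ρW/s ≤ 1/4`.
  refine ⟨4, s / (8 * (W + 1)), by norm_num, by positivity, fun d hd => ?_⟩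
  set ρ := s / (8 * (W + 1)) with hρ
  have hρ0 : 0 < ρ := by positivity
  have hρW : ρ * (8 * (W + 1)) = s := div_mul_cancel₀ _ (by positivity)
  have hρs : ρ * 8 ≤ s := by nlinarith
  set a : zeroSet B → ℂ := fun l => l - d l with ha
  have had : ∀ l : zeroSet B, (l : ℂ) - a l = d l := fun l => sub_sub_cancel _ _
  have haw : ∀ l, ‖a l‖ ≤ ρ * w l * w l := fun l => by
    rw [mul_assoc, ← hwsq]
    exact hd l
  have haw' : ∀ l, ‖a l‖ ≤ ρ * w l := fun l =>
    (haw l).trans (mul_le_of_le_one_right (mul_pos hρ0 (hw0 l)).le (hw1 l))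
  have has : Summable fun l => ‖a l‖ :=
    (hws.mul_left ρ).of_nonneg_of_le (fun _ => norm_nonneg _) haw'
  have hdist : ∀ m l : zeroSet B, l ≠ m → s / 2 * w l ≤ ‖(d m : ℂ) - l‖ := by
    intro m l hne
    have hne' : (m : ℂ) ≠ l := fun h => hne (Subtype.ext h.symm)
    have h1 := hsep l m hne'
    have h2 := hsep m l hne'.symm
    rw [norm_sub_rev] at h2
    have h3 := norm_sub_le_norm_sub_add_norm_sub (m : ℂ) (d m) l
    have h4 : ‖(m : ℂ) - d m‖ ≤ ρ * w m := haw' m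
    have h5 : ρ * w m ≤ s / 8 * w m := mul_le_mul_of_nonneg_right (by linarith) (hw0 m).le
    have h6 : 0 < s * w l := mul_pos hs0 (hw0 l)
    linarith
  have hne : ∀ m : zeroSet B, ∀ l ∈ zeroSet B, l ≠ m → (m : ℂ) - a m ≠ l := by
    intro m l hl hlm h
    have h1 := hdist m ⟨l, hl⟩ fun h => hlm (congrArg Subtype.val h)
    rw [had] at h
    rw [h, sub_self, norm_zero] at h1
    exact (mul_pos (half_pos hs0) (hw0 _)).not_ge h1
  have hzero : zeroSet (moveZeros B a) = Set.range fun l : zeroSet B => (d l : ℂ) := by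
    rw [zeroSet_moveZeros hf hs has hne]
    simp only [had]
  have hderiv : ∀ l : zeroSet B, ‖deriv B l‖ ≤ 4 * ‖deriv (moveZeros B a) (d l)‖ := by
    intro m
    have h1 := deriv_moveZeros hf hs has m (hne m)
    rw [had] at h1
    rw [h1, norm_mul]
    have hg : ‖deriv B m‖ ≤ 2 * ‖dslope B m (d m)‖ := by
      have h2 : ‖(d m : ℂ) - m‖ ≤ ρ * w m := by
        rw [norm_sub_rev]
        exact haw' m
      have h3 : ρ * w m ≤ 1 := mul_le_one₀ (by linarith) (hw0 m).le (hw1 m)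
      have h4 := hds m (d m) (h2.trans h3)
      have h5 : ‖dslope B m (d m) - deriv B m‖ * w m ≤ (c / 2) * w m := by
        calc _ ≤ 2 * M * (ρ * w m) := h4.trans (by gcongr)
          _ = (ρ * (2 * M)) * w m := by ring
          _ ≤ _ := by
            have := hw0 m
            gcongr
            nlinarith
      have h6 := le_of_mul_le_mul_right h5 (hw0 m)
      have h7 := norm_sub_norm_le (deriv B m) (dslope B m (d m))
      rw [norm_sub_rev] at h7
      linarith [hcD m]
    have hp : 1 / 2 ≤ ‖ratioProd (Function.update a m 0) (d m)‖ := by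
      have hterm : ∀ l : zeroSet B,
          ‖Function.update a m 0 l / ((d m : ℂ) - l)‖ ≤ 2 * ρ / s * w l := by
        intro l
        by_cases hl : l = m
        · subst hl
          have := hw0 l
          simp only [Function.update_self, zero_div, norm_zero]
          positivity
        · have hpos : 0 < s / 2 * w l := mul_pos (half_pos hs0) (hw0 l)
          have h2 := hdist m l hl
          rw [Function.update_of_ne hl, norm_div, div_le_iff₀ (hpos.trans_le h2)]
          have := hw0 l
          calc ‖a l‖ ≤ ρ * w l * w l := haw l
            _ = 2 * ρ / s * w l * (s / 2 * w l) := by field_simp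
            _ ≤ _ := by gcongr
      have hsm := (hws.mul_left (2 * ρ / s)).of_nonneg_of_le (fun _ => norm_nonneg _) hterm
      have h2 := hsm.tsum_le_tsum hterm (hws.mul_left _)
      rw [tsum_mul_left] at h2
      have h3 : 2 * ρ / s * W ≤ 1 / 4 := by
        rw [div_mul_eq_mul_div, div_le_iff₀ hs0]
        nlinarith
      have h4 := norm_ratioProd_sub_one_le hsm
      have h5 := Real.exp_le_exp.2 (h2.trans h3)
      have h6 : Real.exp (1 / 4) ≤ 3 / 2 := by
        have := Real.exp_bound_div_one_sub_of_interval (x := 1 / 4) (by norm_num) (by norm_num)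
        norm_num at this ⊢
        linarith
      have h7 := norm_sub_norm_le (1 : ℂ) (ratioProd (Function.update a m 0) (d m))
      rw [norm_one, norm_sub_rev] at h7
      linarith
    nlinarith [norm_nonneg (dslope B m (d m))]
  have hdiff := differentiable_moveZeros hf hs has
  have hsimple : ∀ z ∈ zeroSet (moveZeros B a), deriv (moveZeros B a) z ≠ 0 := by
    intro z hz h0
    rw [hzero] at hz
    obtain ⟨l, rfl⟩ := hz
    have h1 := hderiv l
    simp only [h0, norm_zero, mul_zero] at h1
    exact (hD0 l).not_ge h1
  refine ⟨moveZeros B a, ⟨hdiff, ?_, ?_, ?_, hsimple⟩, hzero, hderiv⟩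
  -- The zero function would have non-simple zeros.
  · obtain ⟨z₀, hz₀⟩ : ∃ z₀, moveZeros B a z₀ ≠ 0 := by
      by_contra! hall
      refine hsimple 0 (hall 0) ?_
      rw [show moveZeros B a = fun _ => 0 from funext hall, deriv_const]
    refine IsMinimalExpType.of_norm_le hdiff (fun ε hε => ?_) hz₀
    obtain ⟨A', hA', hbd'⟩ := hgrow ε hε
    -- This `t` gives `2 ∑ t ≤ 1/2`, while `|a_l|/t_l` is still `O(w_l)`.
    refine ⟨_, ?_, norm_moveZeros_le hf hs has (t := fun l => 1 / (4 * (W + 1)) * w l)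
      (fun l => by have := hw0 l; positivity) (hws.mul_left _) ?_ ?_ hA' hε hbd'⟩
    · positivity
    · rw [tsum_mul_left, ← hW, ← mul_assoc, mul_one_div, div_mul_eq_mul_div,
        div_lt_one (by positivity)]
      linarith
    · refine (hws.mul_left (ρ * (4 * (W + 1)))).of_nonneg_of_le
        (fun l => by have := hw0 l; positivity) fun l => ?_
      have := hw0 l
      rw [div_le_iff₀ (by positivity)]
      refine (haw l).trans (le_of_eq ?_)
      field_simp
  · exact im_moveZeros_eq_zero hf hB.real_on_real hB.zeros_real fun l => by
      simp [ha, hB.zeros_real l l.2]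
  · intro z hz
    rw [hzero] at hz
    obtain ⟨l, rfl⟩ := hz
    exact Complex.ofReal_im _
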